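/- Let $p$ be any prime and let $G=G_{(1,0)}^{(p)}$ be the group of nilpotency class $2$ generated by four elements $a_1,a_2,b_1,b_2$ subject to the defining relations $$a_1^p=[a_1,b_1],\quad a_2^p=[a_1,b_1],\quad b_1^p=[a_2,b_1b_2],\quad b_2^p=[a_2,b_2],\quad [a_1,a_2]=[b_1,b_2]=1$$ (that is, the quotient of the free group on $a_1,a_2,b_1,b_2$ by the normal subgroup generated by all double commutators $[[x,y],z]$ and by these relations). Let $\mathrm{Aut}(G)=\mathrm{End}(G)^{\ast}$, the group of units of the endomorphism monoid $\mathrm{End}(G)$, act on $\mathrm{End}(G)$ by conjugation, $\sigma\cdot\varphi=\sigma\circ\varphi\circ\sigma^{-1}$. Then this action has exactly $3p^{16}-p^{12}$ orbits. Of these, exactly $2p^{16}$ have length $1$, and exactly $p^{12}(p^4-1)$ have length $p^4$. -/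

import Mathlib

open scoped commutatorElement

/-- Names for the four generators `a₁, a₂, b₁, b₂` of a JK-group. -/
inductive JKGen : Type
  | a₁ | a₂ | b₁ | b₂

namespace JKGen

/-- The defining relators of the JK-group with parameters `p` and `lam = (lam.1, lam.2)`:
all double commutators (so that the group has nilpotency class at most `2`), together with the
relations
`a₁ ^ p = [a₁, b₁]`, `a₂ ^ p = [a₁, b₁ ^ lam.1 * b₂ ^ lam.2]`, `b₁ ^ p = [a₂, b₁ * b₂]`,
`b₂ ^ p = [a₂, b₂]`, `[a₁, a₂] = 1`, `[b₁, b₂] = 1`.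
That every element has `p`-power order is a consequence of these relations, since each
generator has its `p`-th power in the centre. -/
inductive IsRelator (p : ℕ) (lam : ℕ × ℕ) : FreeGroup JKGen → Prop
  | classTwo (x y z : FreeGroup JKGen) : IsRelator p lam ⁅⁅x, y⁆, z⁆
  | pow_a₁ : IsRelator p lam
      (FreeGroup.of a₁ ^ p * ⁅FreeGroup.of a₁, FreeGroup.of b₁⁆⁻¹)
  | pow_a₂ : IsRelator p lam
      (FreeGroup.of a₂ ^ p *
        ⁅FreeGroup.of a₁, FreeGroup.of b₁ ^ lam.1 * FreeGroup.of b₂ ^ lam.2⁆⁻¹)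
  | pow_b₁ : IsRelator p lam
      (FreeGroup.of b₁ ^ p * ⁅FreeGroup.of a₂, FreeGroup.of b₁ * FreeGroup.of b₂⁆⁻¹)
  | pow_b₂ : IsRelator p lam
      (FreeGroup.of b₂ ^ p * ⁅FreeGroup.of a₂, FreeGroup.of b₂⁆⁻¹)
  | comm_a : IsRelator p lam ⁅FreeGroup.of a₁, FreeGroup.of a₂⁆
  | comm_b : IsRelator p lam ⁅FreeGroup.of b₁, FreeGroup.of b₂⁆

end JKGen

/-- The JK-group `G_lam^(p)`: the group of nilpotency class `2` generated by `a₁, a₂, b₁, b₂`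
subject to the defining relations. -/
abbrev JKGroup (p : ℕ) (lam : ℕ × ℕ) : Type :=
  PresentedGroup {r : FreeGroup JKGen | JKGen.IsRelator p lam r}

/-- The orbits of the conjugation action of `Aut(G) = End(G)ˣ` on `End(G)`, where a unit `σ` sends
an endomorphism `φ` to `σ ∘ φ ∘ σ⁻¹`. -/
abbrev ConjOrbit (G : Type) [Group G] : Type :=
  MulAction.orbitRel.Quotient (ConjAct (Monoid.End G)ˣ) (Monoid.End G)

/-! The group `G` has order `p ^ 8`: its centre `Z` and the quotient `G / Z` are both copies of `F_p
^ 4`. Commutators and `p`-th powers depend only on classes modulo `Z`; they are given by `commForm`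
and `powForm`. To prove this, `G` is realised as a quotient of an integral Heisenberg group
(`ofHeis`, `toModel`, `central_eq_central`).

Four elements therefore satisfy the defining relations exactly when their classes solve a polynomial
system over `F_p` (`jkRel_iff`). By `IsSol.classify` its solutions are the standard basis and all
quadruples in the line `kerLine`. So an endomorphism either is the identity modulo `Z` or has image
in the line modulo `Z`. Each generator image has `p ^ 4` lifts, which gives `p ^ 16` endomorphisms
of the first kind and `p ^ 20` of the second, `p ^ 16` of the latter having central image.

The units are precisely the endomorphisms of the first kind. They fix `Z` pointwise and commute with
each other, so they are fixed under conjugation. An endomorphism `φ` of the second kind kills `Z`,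
hence `σ φ σ⁻¹ = σ φ`. This equals `φ` when the image of `φ` is central. Otherwise `σ φ` is
determined by the image of one noncentral `φ g₀`, which ranges over a full coset of `Z`, so the
orbit has length `p ^ 4` (`IsLine.ncard_orbit`). The orbits number `2 p ^ 16` and `(p ^ 20 - p ^ 16)
/ p ^ 4`. -/

/-- Quadruples over `R`. -/
abbrev Quad (R : Type) : Type := R × R × R × R

/-! ### The commutator and power forms, and the integral Heisenberg group -/

section Forms

variable {R : Type} [CommRing R]

/-- The tensor product of the first half of `v` with the second half of `w`. -/
def tens (v w : Quad R) : Quad R :=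
  (v.1 * w.2.2.1, v.1 * w.2.2.2, v.2.1 * w.2.2.1, v.2.1 * w.2.2.2)

/-- The linear part of the `p`-th power map of the JK-group with parameters `(1, 0)`. -/
def powLin (v : Quad R) : Quad R :=
  (v.1 + v.2.1, 0, v.2.2.1, v.2.2.1 + v.2.2.2)

/-- The commutator form of the JK-group. -/
def commForm (v w : Quad R) : Quad R := tens v w - tens w v

/-- The `p`-th power map of the JK-group; `c` stands for `p.choose 2`. -/
def powForm (c : R) (v : Quad R) : Quad R := powLin v - c • tens v v

end Forms

/-- The Heisenberg type group on `R⁴ × R⁴` attached to `tens`. -/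
@[ext] structure Heis (R : Type) : Type where
  /-- the class modulo the centre -/
  v : Quad R
  /-- the central coordinate -/
  z : Quad R

namespace Heis

variable {R : Type} [CommRing R]

instance : Mul (Heis R) := ⟨fun g h => ⟨g.v + h.v, g.z + h.z - tens h.v g.v⟩⟩
instance : One (Heis R) := ⟨⟨0, 0⟩⟩
instance : Inv (Heis R) := ⟨fun g => ⟨-g.v, -g.z - tens g.v g.v⟩⟩

@[simp] lemma mul_v (g h : Heis R) : (g * h).v = g.v + h.v := rfl
@[simp] lemma mul_z (g h : Heis R) : (g * h).z = g.z + h.z - tens h.v g.v := rfl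
@[simp] lemma one_v : (1 : Heis R).v = 0 := rfl
@[simp] lemma one_z : (1 : Heis R).z = 0 := rfl
@[simp] lemma inv_v (g : Heis R) : (g⁻¹).v = -g.v := rfl
@[simp] lemma inv_z (g : Heis R) : (g⁻¹).z = -g.z - tens g.v g.v := rfl

instance : Group (Heis R) := Group.ofLeftAxioms
  (by intro a b c; ext <;> simp [tens] <;> ring)
  (by intro a; ext <;> simp [tens])
  (by intro a; ext <;> simp [tens] <;> ring)

lemma commutator_eq (g h : Heis R) : ⁅g, h⁆ = ⟨0, commForm g.v h.v⟩ := by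
  rw [commutatorElement_def]
  ext <;> simp [tens, commForm] <;> ring

lemma pow_eq (g : Heis R) (n : ℕ) :
    g ^ n = ⟨n • g.v, n • g.z - (n.choose 2) • tens g.v g.v⟩ := by
  induction n with
  | zero => ext <;> simp
  | succ n ih =>
    rw [pow_succ, ih, Nat.choose_succ_succ' n 1, Nat.choose_one_right]
    ext <;> simp [tens] <;> ring

/-- The central subgroup generated by `p`-th powers of the generators, corrected by `powLin`, and
by the `p`-th powers of central elements. -/
def powSubgroup (p : ℕ) : Subgroup (Heis ℤ) where
  carrier := {h | ∃ w u : Quad ℤ, h = ⟨(p : ℤ) • w, -powLin w + (p : ℤ) • u⟩}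
  one_mem' := ⟨0, 0, by ext <;> simp [powLin]⟩
  mul_mem' := by
    rintro _ _ ⟨w, u, rfl⟩ ⟨w', u', rfl⟩
    refine ⟨w + w', u + u' - (p : ℤ) • tens w' w, ?_⟩
    ext <;> simp [powLin, tens] <;> ring
  inv_mem' := by
    rintro _ ⟨w, u, rfl⟩
    refine ⟨-w, -u - (p : ℤ) • tens w w, ?_⟩
    ext <;> simp [powLin, tens] <;> ring

instance (p : ℕ) : (powSubgroup p).Normal where
  conj_mem := by
    rintro _ ⟨w, u, rfl⟩ g
    refine ⟨w, u + commForm g.v w, ?_⟩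
    ext <;> simp [powLin, tens, commForm] <;> ring

end Heis

/-! ### Collection of products in groups of class two -/

section ClassTwo

variable {G : Type} [Group G]

lemma mul_comm_of_commutator_central {a b : G} (h : ∀ g, Commute ⁅a, b⁆ g) :
    b * a = a * b * ⁅a, b⁆⁻¹ := by
  have h1 := (h (a * b)).inv_left.eq
  rw [← h1, commutatorElement_def]; group

lemma conj_pow_of_central {b a c : G} (hc : ∀ g, Commute c g) (h : b * a = a * b * c) (n : ℤ) :
    b * a ^ n = a ^ n * b * c ^ n := by
  have h1 : b * a * b⁻¹ = a * c := by
    rw [h, mul_assoc a b c, (hc b).symm.eq]; group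
  have h2 : b * a ^ n * b⁻¹ = a ^ n * c ^ n := by
    rw [← conj_zpow, h1, (hc a).symm.mul_zpow]
  rw [mul_assoc, (((hc b).symm).zpow_right n).eq, ← mul_assoc, ← h2]; group

/-- Two uses of `conj_pow_of_central`: one collects the power of `a`, the other, with the roles
exchanged and `c ^ n` inverted, the power of `b`. -/
lemma zpow_mul_zpow_of_central {b a c : G} (hc : ∀ g, Commute c g) (h : b * a = a * b * c)
    (m n : ℤ) : b ^ m * a ^ n = a ^ n * b ^ m * c ^ (n * m) := by
  have h1 := conj_pow_of_central hc h n
  have h2 : a ^ n * b = b * a ^ n * (c ^ n)⁻¹ := by rw [h1]; group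
  have h3 := conj_pow_of_central (fun g => ((hc g).zpow_left n).inv_left) h2 m
  rw [h3, zpow_mul, inv_zpow]; group

end ClassTwo

/-- Four elements of a group spanning a quotient of the Heisenberg type group. -/
structure HeisGens (G : Type) [Group G] where
  /-- first generator of the first half -/
  a₁ : G
  /-- second generator of the first half -/
  a₂ : G
  /-- first generator of the second half -/
  b₁ : G
  /-- second generator of the second half -/
  b₂ : G
  comm_a : Commute a₁ a₂
  comm_b : Commute b₁ b₂
  central : ∀ x y g : G, Commute ⁅x, y⁆ g

namespace HeisGens

variable {G : Type} [Group G] (t : HeisGens G)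

/-- The ordered product with prescribed exponents in the first half. -/
def prodA (v : Quad ℤ) : G := t.a₁ ^ v.1 * t.a₂ ^ v.2.1

/-- The ordered product with prescribed exponents in the second half. -/
def prodB (v : Quad ℤ) : G := t.b₁ ^ v.2.2.1 * t.b₂ ^ v.2.2.2

/-- The product of commutators with prescribed exponents. -/
def prodC (z : Quad ℤ) : G :=
  ⁅t.a₁, t.b₁⁆ ^ z.1 * ⁅t.a₁, t.b₂⁆ ^ z.2.1 * ⁅t.a₂, t.b₁⁆ ^ z.2.2.1 * ⁅t.a₂, t.b₂⁆ ^ z.2.2.2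

lemma prodA_add (v w : Quad ℤ) : t.prodA (v + w) = t.prodA v * t.prodA w := by
  have h := (t.comm_a.zpow_zpow w.1 v.2.1).symm.eq
  simp only [prodA, Prod.fst_add, Prod.snd_add, zpow_add, mul_assoc]
  rw [← mul_assoc (t.a₂ ^ v.2.1), h]
  simp only [mul_assoc]

lemma prodB_add (v w : Quad ℤ) : t.prodB (v + w) = t.prodB v * t.prodB w := by
  have h := (t.comm_b.zpow_zpow w.2.2.1 v.2.2.2).symm.eq
  simp only [prodB, Prod.fst_add, Prod.snd_add, zpow_add, mul_assoc]
  rw [← mul_assoc (t.b₂ ^ v.2.2.2), h]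
  simp only [mul_assoc]

lemma prodC_central (z : Quad ℤ) (g : G) : Commute (t.prodC z) g :=
  ((((t.central _ _ g).zpow_left _).mul_left ((t.central _ _ g).zpow_left _)).mul_left
    ((t.central _ _ g).zpow_left _)).mul_left ((t.central _ _ g).zpow_left _)

lemma prodC_add (z w : Quad ℤ) : t.prodC (z + w) = t.prodC z * t.prodC w := by
  have key : ∀ x y g k : G, ∀ m n : ℤ,
      g * ⁅x, y⁆ ^ m * (k * ⁅x, y⁆ ^ n) = g * k * (⁅x, y⁆ ^ m * ⁅x, y⁆ ^ n) :=
    fun x y g k m n => (((t.central x y k).zpow_left m).mul_mul_mul_comm g _)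
  simp only [prodC, Prod.fst_add, Prod.snd_add, zpow_add]
  rw [key, key, key]

/-- The collection rule that matches the cocycle in the multiplication of `Heis`: each power of a
`b` moved past a power of an `a` leaves a central commutator. -/
lemma prodB_mul_prodA (v w : Quad ℤ) :
    t.prodB v * t.prodA w = t.prodA w * t.prodB v * t.prodC (-tens w v) := by
  have key : ∀ x y : G, ∀ m n : ℤ,
      y ^ m * x ^ n = ⁅x, y⁆ ^ (-(n * m)) * (x ^ n * y ^ m) := by
    intro x y m n
    rw [zpow_mul_zpow_of_central (fun g => (t.central x y g).inv_left)
      (mul_comm_of_commutator_central (t.central x y)) m n,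
      ← (((t.central x y _).inv_left).zpow_left (n * m)).eq, inv_zpow, zpow_neg]
  have push : ∀ x y : G, ∀ m : ℤ, ∀ g k : G, g * (⁅x, y⁆ ^ m * k) = ⁅x, y⁆ ^ m * (g * k) := by
    intro x y m g k
    rw [← mul_assoc, ← ((t.central x y g).zpow_left m).eq, mul_assoc]
  have key' : ∀ x y : G, ∀ m n : ℤ, ∀ k : G,
      y ^ m * (x ^ n * k) = ⁅x, y⁆ ^ (-(n * m)) * (x ^ n * (y ^ m * k)) := by
    intro x y m n k
    rw [← mul_assoc, key]; simp only [mul_assoc]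
  rw [← (t.prodC_central _ _).eq]
  simp only [prodA, prodB, prodC, tens, mul_assoc, Prod.fst_neg, Prod.snd_neg]
  rw [key' t.a₁ t.b₂, push t.a₁ t.b₂, key' t.a₁ t.b₁, push t.a₁ t.b₂, key t.a₂ t.b₂,
    push t.a₂ t.b₂ _ (t.b₁ ^ _), key' t.a₂ t.b₁, push t.a₂ t.b₁ _ (⁅t.a₂, t.b₂⁆ ^ _),
    push t.a₂ t.b₁ _ (t.a₁ ^ _), push t.a₂ t.b₂ _ (t.a₁ ^ _), push t.a₁ t.b₁]

/-- The homomorphism from the Heisenberg type group given by four generators. -/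
def toHom : Heis ℤ →* G := MonoidHom.mk' (fun h => t.prodA h.v * t.prodB h.v * t.prodC h.z) <| by
  intro g h
  have h1 := t.prodB_mul_prodA g.v h.v
  have h2 := (t.prodC_central g.z (t.prodA h.v * t.prodB h.v)).eq
  have h3 := (t.prodC_central (-tens h.v g.v) (t.prodB h.v)).eq
  calc t.prodA (g * h).v * t.prodB (g * h).v * t.prodC (g * h).z
      = t.prodA g.v * (t.prodA h.v * t.prodB g.v * (t.prodB h.v * t.prodC (-tens h.v g.v)))
          * t.prodC g.z * t.prodC h.z := by
        rw [Heis.mul_v, Heis.mul_z, prodA_add, prodB_add,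
          show g.z + h.z - tens h.v g.v = -tens h.v g.v + g.z + h.z by abel, prodC_add, prodC_add]
        simp only [mul_assoc]
    _ = t.prodA g.v * ((t.prodA h.v * t.prodB g.v * t.prodC (-tens h.v g.v)) * t.prodB h.v)
          * t.prodC g.z * t.prodC h.z := by rw [← h3]; simp only [mul_assoc]
    _ = t.prodA g.v * t.prodB g.v * ((t.prodA h.v * t.prodB h.v) * t.prodC g.z) * t.prodC h.z := by
        rw [← h1]; simp only [mul_assoc]
    _ = t.prodA g.v * t.prodB g.v * t.prodC g.z * (t.prodA h.v * t.prodB h.v * t.prodC h.z) := by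
        rw [← h2]; simp only [mul_assoc]

lemma toHom_apply (h : Heis ℤ) : t.toHom h = t.prodA h.v * t.prodB h.v * t.prodC h.z := rfl

end HeisGens

/-! ### The relations modulo the centre and their solutions -/

/-- The equations satisfied modulo the centre by the images of the four generators under an
endomorphism of the JK-group with parameters `(1, 0)`. -/
structure IsSol {R : Type} [CommRing R] (c : R) (u₁ u₂ w₁ w₂ : Quad R) : Prop where
  pow_u₁ : powForm c u₁ = commForm u₁ w₁
  pow_u₂ : powForm c u₂ = commForm u₁ w₁
  pow_w₁ : powForm c w₁ = commForm u₂ (w₁ + w₂)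
  pow_w₂ : powForm c w₂ = commForm u₂ w₂
  comm_u : commForm u₁ u₂ = 0
  comm_w : commForm w₁ w₂ = 0

/-- The line of elements whose lifts have order dividing `p`. -/
def kerLine {R : Type} [CommRing R] (f : R) : Quad R := (f, -f, 0, 0)

lemma eq_kerLine {R : Type} [CommRing R] {v : Quad R} (h1 : v.1 + v.2.1 = 0) (h2 : v.2.2.1 = 0)
    (h3 : v.2.2.2 = 0) : v = kerLine v.1 := by
  ext
  · rfl
  · exact (neg_eq_of_add_eq_zero_right h1).symm
  · exact h2
  · exact h3

/-- When `u₁` and `u₂` have zero second half, every commutator with them is a pure tensor. The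
scalar `x₁ + x₂` decides: if it vanishes everything collapses into the line, otherwise the equations
force the standard basis. -/
lemma eq_zero_or_kerLine_of_mem_firstHalf {F : Type} [Field F] {x₁ x₂ x₁' x₂' : F} {w₁ w₂ : Quad F}
    (h : IsSol 0 (x₁, x₂, 0, 0) (x₁', x₂', 0, 0) w₁ w₂) :
    ((x₁, x₂) = (1, 0) ∧ (x₁', x₂') = (0, 1) ∧ w₁ = (0, 0, 1, 0) ∧ w₂ = (0, 0, 0, 1)) ∨
    (x₁ + x₂ = 0 ∧ x₁' + x₂' = 0 ∧ w₁ = kerLine w₁.1 ∧ w₂ = kerLine w₂.1) := by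
  obtain ⟨α₁, α₂, γ₁, γ₂⟩ := w₁
  obtain ⟨β₁, β₂, δ₁, δ₂⟩ := w₂
  obtain ⟨h1, h2, h3, h4, -, h6⟩ := h
  simp only [powForm, commForm, powLin, tens, Prod.ext_iff, Prod.fst_sub, Prod.snd_sub, Prod.fst_add,
    Prod.snd_add, Prod.fst_zero, Prod.snd_zero, zero_smul, sub_zero, mul_zero] at h1 h2 h3 h4 h6
  obtain ⟨a1, a2, a3, a4⟩ := h1
  obtain ⟨b1, -, -, -⟩ := h2
  obtain ⟨c1, c2, c3, c4⟩ := h3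
  obtain ⟨d1, d2, d3, d4⟩ := h4
  obtain ⟨e1, e2, e3, e4⟩ := h6
  by_cases hs : x₁ + x₂ = 0
  · right
    have hx' : x₂' = -x₁' := by linear_combination b1 - a1 + hs
    subst hx'
    have hδ2 : δ₂ = 0 := by
      by_cases h0 : x₁' = 0
      · subst h0; grind
      · grind
    have hδ1 : δ₁ = 0 := by grind
    subst hδ2 hδ1
    have hγ2 : γ₂ = 0 := by
      by_cases h0 : x₁' = 0
      · subst h0; grind
      · grind
    have hγ1 : γ₁ = 0 := by grind
    subst hγ2 hγ1
    refine ⟨hs, by ring, eq_kerLine ?_ rfl rfl, eq_kerLine ?_ rfl rfl⟩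
    · simpa using c1
    · simpa using d1
  · left
    rw [a1] at hs
    have hx1 : x₁ ≠ 0 := left_ne_zero_of_mul hs
    have hγ1 : γ₁ ≠ 0 := right_ne_zero_of_mul hs
    have hγ2 : γ₂ = 0 := by grind
    have hx2 : x₂ = 0 := by grind
    have hγ : γ₁ = 1 := by grind
    subst hγ2 hx2 hγ
    have hδ1 : δ₁ = 0 := by grind
    have hδ2 : δ₂ = 1 := by grind
    subst hδ1 hδ2
    have h7 : x₂' = 1 := by grind
    have h8 : x₁' = 0 := by grind
    have h9 : x₁ = 1 := by grind
    subst h7 h8 h9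
    simp only [Prod.ext_iff]
    grind

/-- Here the power map is linear with kernel `kerLine`. If the second half of `u₂` were nonzero,
then `u₁ = u₂`, and comparing powers would determine `w₁` up to the kernel line; the remaining
equations are contradictory. -/
lemma IsSol.classify_of_zero {F : Type} [Field F] {u₁ u₂ w₁ w₂ : Quad F}
    (h : IsSol 0 u₁ u₂ w₁ w₂) :
    (u₁ = (1, 0, 0, 0) ∧ u₂ = (0, 1, 0, 0) ∧ w₁ = (0, 0, 1, 0) ∧ w₂ = (0, 0, 0, 1)) ∨
    (u₁ = kerLine u₁.1 ∧ u₂ = kerLine u₂.1 ∧ w₁ = kerLine w₁.1 ∧ w₂ = kerLine w₂.1) := by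
  by_cases hu : u₂.2.2 = 0
  · have h0 := h
    obtain ⟨h1, h2, -, -, -, -⟩ := h
    obtain ⟨x₁, x₂, y₁, y₂⟩ := u₁
    obtain ⟨x₁', x₂', y₁', y₂'⟩ := u₂
    have hy : y₁ = 0 ∧ y₂ = 0 ∧ y₁' = 0 ∧ y₂' = 0 := by
      rw [← h2] at h1
      simp only [powForm, powLin, Prod.ext_iff, zero_smul, sub_zero, Prod.fst_zero,
        Prod.snd_zero] at h1 hu
      grind
    obtain ⟨rfl, rfl, rfl, rfl⟩ := hy
    rcases eq_zero_or_kerLine_of_mem_firstHalf h0 with ⟨k1, k2, k3, k4⟩ | ⟨k1, k2, k3, k4⟩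
    · left
      simp only [Prod.ext_iff] at k1 k2 ⊢
      grind
    · exact Or.inr ⟨eq_kerLine k1 rfl rfl, eq_kerLine k2 rfl rfl, k3, k4⟩
  · exfalso
    obtain ⟨x₁, x₂, y₁, y₂⟩ := u₁
    obtain ⟨x₁', x₂', y₁', y₂'⟩ := u₂
    obtain ⟨α₁, α₂, γ₁, γ₂⟩ := w₁
    obtain ⟨β₁, β₂, δ₁, δ₂⟩ := w₂
    obtain ⟨h1, h2, h3, h4, h5, h6⟩ := h
    simp only [powForm, commForm, powLin, tens, Prod.ext_iff, Prod.fst_sub, Prod.snd_sub,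
      Prod.fst_add, Prod.snd_add, Prod.fst_zero, Prod.snd_zero, zero_smul, sub_zero]
      at h1 h2 h3 h4 h5 h6 hu
    obtain ⟨a1, a2, a3, a4⟩ := h1
    obtain ⟨b1, b2, b3, b4⟩ := h2
    obtain ⟨c1, c2, c3, c4⟩ := h3
    obtain ⟨d1, d2, d3, d4⟩ := h4
    obtain ⟨e1, e2, e3, e4⟩ := h5
    obtain ⟨f1, f2, f3, f4⟩ := h6
    -- `u₁` and `u₂` have equal powers, and the power map is injective on second halves.
    have hy1 : y₁ = y₁' := by linear_combination a3 - b3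
    have hy2 : y₂ = y₂' := by linear_combination a4 - b4 - a3 + b3
    subst hy1 hy2
    have hy : ∀ s, s * y₁ = 0 → s * y₂ = 0 → s = 0 := by
      intro s s1 s2
      by_contra hs
      exact hu ⟨(mul_eq_zero.1 s1).resolve_left hs, (mul_eq_zero.1 s2).resolve_left hs⟩
    -- With equal second halves `y ≠ 0`, the relation `[u₁, u₂] = 0` reads `(x - x') ⊗ y = 0`.
    have hx1 : x₁ = x₁' := sub_eq_zero.1 (hy _ (by rw [sub_mul, e1]) (by rw [sub_mul, e2]))
    have hx2 : x₂ = x₂' := sub_eq_zero.1 (hy _ (by rw [sub_mul, e3]) (by rw [sub_mul, e4]))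
    subst hx1 hx2
    clear e1 e2 e3 e4 b1 b2 b3 b4
    -- `w₁ = u + w₂ + k (1, -1, 0, 0)`
    have hγ1 : γ₁ = y₁ + δ₁ := by linear_combination c3 - a3 - d3
    have hγ2 : γ₂ = y₂ + δ₂ := by linear_combination c4 - a4 - d4 - c3 + a3 + d3
    obtain ⟨k, hk⟩ : ∃ k, α₁ = x₁ + β₁ + k := ⟨α₁ - x₁ - β₁, by ring⟩
    have hα2 : α₂ = x₂ + β₂ - k := by linear_combination c1 - a1 - d1 - hk
    subst hγ1 hγ2 hk hα2
    have g2 : k * y₂ = 0 := by linear_combination a2 - d2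
    have g3 : y₁ - δ₁ = k * y₁ := by linear_combination a3 - d3
    have g4 : y₁ + y₂ - δ₁ - δ₂ = 0 := by linear_combination a4 - d4 + g2
    by_cases hk : k = 0
    · subst hk
      have hδ1 : δ₁ = y₁ := by linear_combination -g3
      have hδ2 : δ₂ = y₂ := by linear_combination -g4 + g3
      subst hδ1 hδ2
      -- For `k = 0` the elements `w₂` and `u` have equal powers, so they differ by `j (1, -1, 0,
      -- 0)`.
      obtain ⟨j, hj⟩ : ∃ j, β₁ = x₁ + j := ⟨β₁ - x₁, by ring⟩
      have hβ2 : β₂ = x₂ - j := by linear_combination d1 - a1 - hj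
      subst hj hβ2
      have i2 : j * δ₂ = 0 := by linear_combination d2
      have i3 : δ₁ = j * δ₁ := by linear_combination d3
      have i4 : δ₁ + δ₂ = 0 := by linear_combination d4 + i2
      have i5 : δ₁ = 0 := by linear_combination i3 + j * i4 - i2
      exact hu ⟨i5, by rw [← i4, i5, zero_add]⟩
    · have hy2 : y₂ = 0 := (mul_eq_zero.1 g2).resolve_left hk
      subst hy2
      have hy1 : y₁ ≠ 0 := fun h => hu ⟨h, rfl⟩
      have hδ1 : δ₁ = y₁ - k * y₁ := by linear_combination -g3
      have hδ2 : δ₂ = k * y₁ := by linear_combination -g4 - hδ1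
      subst hδ2 hδ1
      -- The second coordinate of `[w₁, w₂] = 0`: the contribution of `[u, w₂]` vanishes because
      -- powers have zero second coordinate.
      have : k * (k * y₁) = 0 := by linear_combination f2 + d2
      exact mul_ne_zero hk (mul_ne_zero hk hy1) this

-- For `p = 2` the coefficient `p.choose 2` is `1`, so the power map is quadratic; the finitely many
-- cases are checked directly.
set_option synthInstance.maxSize 2000 in
set_option synthInstance.maxHeartbeats 400000 in
set_option maxHeartbeats 1000000 in
lemma IsSol.classify_zmod_two {u₁ u₂ w₁ w₂ : Quad (ZMod 2)} (h : IsSol 1 u₁ u₂ w₁ w₂) :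
    (u₁ = (1, 0, 0, 0) ∧ u₂ = (0, 1, 0, 0) ∧ w₁ = (0, 0, 1, 0) ∧ w₂ = (0, 0, 0, 1)) ∨
    (u₁ = kerLine u₁.1 ∧ u₂ = kerLine u₂.1 ∧ w₁ = kerLine w₁.1 ∧ w₂ = kerLine w₂.1) := by
  -- Each equation is placed right after the variables it involves, so that the search is pruned
  -- early.
  have key : ∀ u₁ u₂ : Quad (ZMod 2), powForm 1 u₁ = powForm 1 u₂ → commForm u₁ u₂ = 0 →
      ∀ w₁, powForm 1 u₁ = commForm u₁ w₁ → ∀ w₂, powForm 1 w₂ = commForm u₂ w₂ →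
      commForm w₁ w₂ = 0 → powForm 1 w₁ = commForm u₂ (w₁ + w₂) →
    (u₁ = (1, 0, 0, 0) ∧ u₂ = (0, 1, 0, 0) ∧ w₁ = (0, 0, 1, 0) ∧ w₂ = (0, 0, 0, 1)) ∨
    (u₁ = kerLine u₁.1 ∧ u₂ = kerLine u₂.1 ∧ w₁ = kerLine w₁.1 ∧ w₂ = kerLine w₂.1) := by
    decide +kernel
  exact key u₁ u₂ (h.pow_u₁.trans h.pow_u₂.symm) h.comm_u w₁ h.pow_u₁ w₂ h.pow_w₂ h.comm_w h.pow_w₁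

lemma IsSol.classify {p : ℕ} [Fact p.Prime] {u₁ u₂ w₁ w₂ : Quad (ZMod p)}
    (h : IsSol (p.choose 2 : ZMod p) u₁ u₂ w₁ w₂) :
    (u₁ = (1, 0, 0, 0) ∧ u₂ = (0, 1, 0, 0) ∧ w₁ = (0, 0, 1, 0) ∧ w₂ = (0, 0, 0, 1)) ∨
    (u₁ = kerLine u₁.1 ∧ u₂ = kerLine u₂.1 ∧ w₁ = kerLine w₁.1 ∧ w₂ = kerLine w₂.1) := by
  have hp := Fact.out (p := p.Prime)
  rcases hp.eq_two_or_odd' with rfl | hodd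
  · exact IsSol.classify_zmod_two (by rwa [Nat.choose_self, Nat.cast_one] at h)
  · have h2 : 2 < p := lt_of_le_of_ne hp.two_le (by rintro rfl; exact absurd hodd (by decide))
    have h0 : (p.choose 2 : ZMod p) = 0 :=
      (ZMod.natCast_eq_zero_iff _ _).2 (hp.dvd_choose_self two_ne_zero h2)
    exact IsSol.classify_of_zero (by rwa [h0] at h)

lemma isSol_kerLine {R : Type} [CommRing R] (c f₁ f₂ f₃ f₄ : R) :
    IsSol c (kerLine f₁) (kerLine f₂) (kerLine f₃) (kerLine f₄) := by
  constructor <;> simp [powForm, powLin, commForm, tens, kerLine]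

/-! ### The universal property and the Heisenberg model -/

/-- The defining relations of the JK-group with parameters `(1, 0)`, for four elements of a group
of class at most two. -/
structure JKRel (p : ℕ) {H : Type} [Group H] (f : JKGen → H) : Prop where
  pow_a₁ : f .a₁ ^ p = ⁅f .a₁, f .b₁⁆
  pow_a₂ : f .a₂ ^ p = ⁅f .a₁, f .b₁⁆
  pow_b₁ : f .b₁ ^ p = ⁅f .a₂, f .b₁ * f .b₂⁆
  pow_b₂ : f .b₂ ^ p = ⁅f .a₂, f .b₂⁆
  comm_a : ⁅f .a₁, f .a₂⁆ = 1
  comm_b : ⁅f .b₁, f .b₂⁆ = 1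

namespace JKGroup

/-- The universal property of the JK-group. -/
def lift {p : ℕ} {H : Type} [Group H] (hc : ∀ x y z : H, ⁅⁅x, y⁆, z⁆ = 1) {f : JKGen → H}
    (hf : JKRel p f) : JKGroup p (1, 0) →* H :=
  PresentedGroup.toGroup (f := f) <| by
    rintro r (⟨x, y, z⟩ | _ | _ | _ | _ | _ | _)
    · simp only [map_commutatorElement]; exact hc _ _ _
    · rw [map_mul, map_inv, mul_inv_eq_one]; simp [map_commutatorElement, hf.pow_a₁]
    · rw [map_mul, map_inv, mul_inv_eq_one]; simp [map_commutatorElement, hf.pow_a₂]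
    · rw [map_mul, map_inv, mul_inv_eq_one]; simp [map_commutatorElement, hf.pow_b₁]
    · rw [map_mul, map_inv, mul_inv_eq_one]; simp [map_commutatorElement, hf.pow_b₂]
    · simp [map_commutatorElement, hf.comm_a]
    · simp [map_commutatorElement, hf.comm_b]

@[simp] lemma lift_of {p : ℕ} {H : Type} [Group H] (hc : ∀ x y z : H, ⁅⁅x, y⁆, z⁆ = 1)
    {f : JKGen → H} (hf : JKRel p f) (s : JKGen) :
    lift hc hf (PresentedGroup.of s) = f s := PresentedGroup.toGroup.of _

variable (p : ℕ)

/-- The generators of the JK-group. -/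
def gen (s : JKGen) : JKGroup p (1, 0) := PresentedGroup.of s

lemma jkRel_gen : JKRel p (gen p) := by
  have h : ∀ {r}, JKGen.IsRelator p (1, 0) r →
    PresentedGroup.mk {r : FreeGroup JKGen | JKGen.IsRelator p (1, 0) r} r = 1 :=
    fun hr => PresentedGroup.one_of_mem hr
  constructor
  · have := h .pow_a₁
    rwa [map_mul, map_inv, mul_inv_eq_one, map_pow, map_commutatorElement] at this
  · have := h .pow_a₂
    rwa [map_mul, map_inv, mul_inv_eq_one, map_pow, map_commutatorElement, pow_one, pow_zero,
      mul_one] at this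
  · have := h .pow_b₁
    rwa [map_mul, map_inv, mul_inv_eq_one, map_pow, map_commutatorElement, map_mul] at this
  · have := h .pow_b₂
    rwa [map_mul, map_inv, mul_inv_eq_one, map_pow, map_commutatorElement] at this
  · have := h .comm_a
    rwa [map_commutatorElement] at this
  · have := h .comm_b
    rwa [map_commutatorElement] at this

variable {p}

lemma class_two (x y z : JKGroup p (1, 0)) : ⁅⁅x, y⁆, z⁆ = 1 := by
  obtain ⟨x, rfl⟩ := PresentedGroup.mk_surjective _ x
  obtain ⟨y, rfl⟩ := PresentedGroup.mk_surjective _ y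
  obtain ⟨z, rfl⟩ := PresentedGroup.mk_surjective _ z
  rw [← map_commutatorElement, ← map_commutatorElement]
  exact PresentedGroup.one_of_mem (.classTwo x y z)

lemma commutator_central (x y g : JKGroup p (1, 0)) : Commute ⁅x, y⁆ g :=
  commutatorElement_eq_one_iff_commute.1 (class_two x y g)

variable (p)

/-- The generators of the JK-group, as generators of a quotient of the Heisenberg type group. -/
def heisGens : HeisGens (JKGroup p (1, 0)) where
  a₁ := gen p .a₁
  a₂ := gen p .a₂
  b₁ := gen p .b₁
  b₂ := gen p .b₂
  comm_a := commutatorElement_eq_one_iff_commute.1 (jkRel_gen p).comm_a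
  comm_b := commutatorElement_eq_one_iff_commute.1 (jkRel_gen p).comm_b
  central := commutator_central

/-- The JK-group as a quotient of the Heisenberg type group over `ℤ`. -/
def ofHeis : Heis ℤ →* JKGroup p (1, 0) := (heisGens p).toHom

/-- The standard generators of the Heisenberg type group. -/
def heisGen : JKGen → Heis ℤ
  | .a₁ => ⟨(1, 0, 0, 0), 0⟩
  | .a₂ => ⟨(0, 1, 0, 0), 0⟩
  | .b₁ => ⟨(0, 0, 1, 0), 0⟩
  | .b₂ => ⟨(0, 0, 0, 1), 0⟩

lemma ofHeis_heisGen (s : JKGen) : ofHeis p (heisGen s) = gen p s := by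
  cases s <;>
  simp [ofHeis, HeisGens.toHom_apply, heisGen, HeisGens.prodA, HeisGens.prodB, HeisGens.prodC,
    heisGens]

lemma ofHeis_surjective : Function.Surjective (ofHeis p) := fun x =>
  PresentedGroup.generated_by _ (ofHeis p).range (fun s => ⟨heisGen s, ofHeis_heisGen p s⟩) x

lemma jkRel_heisGen : JKRel p fun s =>
    (QuotientGroup.mk (heisGen s) : Heis ℤ ⧸ Heis.powSubgroup p) := by
  have key : ∀ g h : Heis ℤ, g⁻¹ * h ∈ Heis.powSubgroup p →
    (QuotientGroup.mk g : Heis ℤ ⧸ Heis.powSubgroup p) = QuotientGroup.mk h :=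
    fun g h hgh => QuotientGroup.eq.2 hgh
  have hcomm : ∀ g h : Heis ℤ, ⁅(QuotientGroup.mk g : Heis ℤ ⧸ Heis.powSubgroup p),
    QuotientGroup.mk h⁆ = QuotientGroup.mk ⁅g, h⁆ := fun g h =>
    (map_commutatorElement (QuotientGroup.mk' _) g h).symm
  constructor <;> simp only [← QuotientGroup.mk_pow, ← QuotientGroup.mk_mul, hcomm,
    ← QuotientGroup.mk_one (Heis.powSubgroup p)] <;> apply key <;>
    rw [Heis.commutator_eq]
  -- The quotient of the commutator by the `p`-th power has first component `-p` times the basis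
  -- vector, whence the sign of the witness.
  · refine ⟨-(1, 0, 0, 0), 0, ?_⟩
    rw [Heis.pow_eq]; ext <;> simp [heisGen, commForm, tens, powLin]
  · refine ⟨-(0, 1, 0, 0), 0, ?_⟩
    rw [Heis.pow_eq]; ext <;> simp [heisGen, commForm, tens, powLin]
  · refine ⟨-(0, 0, 1, 0), 0, ?_⟩
    rw [Heis.pow_eq]; ext <;> simp [heisGen, commForm, tens, powLin]
  · refine ⟨-(0, 0, 0, 1), 0, ?_⟩
    rw [Heis.pow_eq]; ext <;> simp [heisGen, commForm, tens, powLin]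
  · refine ⟨0, 0, ?_⟩
    ext <;> simp [heisGen, commForm, tens, powLin]
  · refine ⟨0, 0, ?_⟩
    ext <;> simp [heisGen, commForm, tens, powLin]

/-- The map from the JK-group to its model as a quotient of the Heisenberg type group. -/
def toModel : JKGroup p (1, 0) →* Heis ℤ ⧸ Heis.powSubgroup p :=
  lift (by
    intro x y z
    induction x using QuotientGroup.induction_on with | _ x
    induction y using QuotientGroup.induction_on with | _ y
    induction z using QuotientGroup.induction_on with | _ z
    change (QuotientGroup.mk ⁅⁅x, y⁆, z⁆ : Heis ℤ ⧸ Heis.powSubgroup p) = QuotientGroup.mk 1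
    congr 1
    rw [Heis.commutator_eq, Heis.commutator_eq]
    ext <;> simp [commForm, tens]) (jkRel_heisGen p)

/-- The hypothesis removes the binomial term; it holds for the standard generators and their
commutators. -/
lemma _root_.Heis.zpow_eq {R : Type} [CommRing R] (g : Heis R) (h : tens g.v g.v = 0) (n : ℤ) :
    g ^ n = ⟨n • g.v, n • g.z⟩ := by
  cases n with
  | ofNat n => rw [Int.ofNat_eq_natCast, zpow_natCast, Heis.pow_eq, h]; ext <;> simp
  | negSucc n =>
    rw [zpow_negSucc, Heis.pow_eq, h, Int.negSucc_eq]
    simp only [tens, Prod.ext_iff, Prod.fst_zero, Prod.snd_zero] at h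
    obtain ⟨h1, h2, h3, h4⟩ := h
    ext <;> simp [tens] <;> grind

lemma toModel_ofHeis (h : Heis ℤ) : toModel p (ofHeis p h) = QuotientGroup.mk h := by
  have hgen : ∀ s, toModel p (gen p s) = QuotientGroup.mk' _ (heisGen s) :=
    fun s => lift_of _ (jkRel_heisGen p) s
  have : h = heisGen .a₁ ^ h.v.1 * heisGen .a₂ ^ h.v.2.1 *
      (heisGen .b₁ ^ h.v.2.2.1 * heisGen .b₂ ^ h.v.2.2.2) *
      (⁅heisGen .a₁, heisGen .b₁⁆ ^ h.z.1 * ⁅heisGen .a₁, heisGen .b₂⁆ ^ h.z.2.1 *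
        ⁅heisGen .a₂, heisGen .b₁⁆ ^ h.z.2.2.1 * ⁅heisGen .a₂, heisGen .b₂⁆ ^ h.z.2.2.2) := by
    simp only [Heis.commutator_eq]
    rw [Heis.zpow_eq, Heis.zpow_eq, Heis.zpow_eq, Heis.zpow_eq, Heis.zpow_eq, Heis.zpow_eq,
      Heis.zpow_eq, Heis.zpow_eq]
    · ext <;> simp [heisGen, commForm, tens]
    all_goals simp [heisGen, tens]
  conv_rhs => rw [this]
  change _ = QuotientGroup.mk' _ _
  simp only [ofHeis, HeisGens.toHom_apply, HeisGens.prodA, HeisGens.prodB, HeisGens.prodC, heisGens,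
    map_mul, map_zpow, map_commutatorElement, hgen]

/-! ### The centre as a copy of `F_p ^ 4` -/

variable {p}

lemma commutator_pow_eq_one {x y : JKGroup p (1, 0)} (h : Commute (x ^ p) y) : ⁅x, y⁆ ^ p = 1 := by
  have h1 := conj_pow_of_central (fun g => (commutator_central x y g).inv_left)
    (mul_comm_of_commutator_central (commutator_central x y)) p
  rw [zpow_natCast, zpow_natCast, h.symm.eq, left_eq_mul, inv_pow, inv_eq_one] at h1
  exact h1

variable (p)

/-- The map from quadruples of integers to the centre of the JK-group. -/
def central (z : Quad ℤ) : JKGroup p (1, 0) := ofHeis p ⟨0, z⟩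

lemma central_eq (z : Quad ℤ) : central p z = (heisGens p).prodC z := by
  simp [central, ofHeis, HeisGens.toHom_apply, HeisGens.prodA, HeisGens.prodB]

lemma central_add (z w : Quad ℤ) : central p (z + w) = central p z * central p w := by
  simp only [central_eq, HeisGens.prodC_add]

lemma central_commute (z : Quad ℤ) (g : JKGroup p (1, 0)) : Commute (central p z) g := by
  rw [central_eq]; exact (heisGens p).prodC_central z g

/-- Each `aᵢ ^ p` is a commutator, hence central, so `[aᵢ, bⱼ] ^ p = [aᵢ ^ p, bⱼ] = 1`. -/
lemma central_smul (z : Quad ℤ) : central p ((p : ℤ) • z) = 1 := by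
  have ha₁ : ∀ y, Commute (gen p .a₁ ^ p) y := by
    rw [(jkRel_gen p).pow_a₁]; exact commutator_central _ _
  have ha₂ : ∀ y, Commute (gen p .a₂ ^ p) y := by
    rw [(jkRel_gen p).pow_a₂]; exact commutator_central _ _
  have h : ∀ x y : JKGroup p (1, 0), Commute (x ^ p) y → ∀ n : ℤ, ⁅x, y⁆ ^ ((p : ℤ) * n) = 1 := by
    intro x y hxy n
    rw [zpow_mul, zpow_natCast, commutator_pow_eq_one hxy, one_zpow]
  rw [central_eq]
  simp [HeisGens.prodC, heisGens, h _ _ (ha₁ _), h _ _ (ha₂ _)]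

lemma commutator_ofHeis (g h : Heis ℤ) :
    ⁅ofHeis p g, ofHeis p h⁆ = central p (commForm g.v h.v) := by
  rw [← map_commutatorElement, Heis.commutator_eq, central]

lemma ofHeis_smul (w z : Quad ℤ) :
    ofHeis p ⟨(p : ℤ) • w, z⟩ = central p (powLin w + z) := by
  have hb : gen p .b₁ ^ p = central p (0, 0, 1, 1) := by
    rw [(jkRel_gen p).pow_b₁, ← ofHeis_heisGen, ← ofHeis_heisGen, ← ofHeis_heisGen, ← map_mul,
      commutator_ofHeis]
    simp [heisGen, commForm, tens]
  have hb₂ : gen p .b₂ ^ p = central p (0, 0, 0, 1) := by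
    rw [(jkRel_gen p).pow_b₂, ← ofHeis_heisGen, ← ofHeis_heisGen, commutator_ofHeis]
    simp [heisGen, commForm, tens]
  have ha₁ : gen p .a₁ ^ p = central p (1, 0, 0, 0) := by
    rw [(jkRel_gen p).pow_a₁, ← ofHeis_heisGen, ← ofHeis_heisGen, commutator_ofHeis]
    simp [heisGen, commForm, tens]
    rfl
  have ha₂ : gen p .a₂ ^ p = central p (1, 0, 0, 0) := by
    rw [(jkRel_gen p).pow_a₂, ← ofHeis_heisGen, ← ofHeis_heisGen, commutator_ofHeis]
    simp [heisGen, commForm, tens]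
    rfl
  have hz : ∀ (u : Quad ℤ) (n : ℤ), central p u ^ n = central p (n • u) := by
    intro u n
    rw [central, ← map_zpow, Heis.zpow_eq _ (by simp [tens])]
    simp [central]
  rw [central_add, central_eq p z]
  simp only [ofHeis, HeisGens.toHom_apply, HeisGens.prodA, HeisGens.prodB]
  simp only [heisGens, Prod.smul_fst, Prod.smul_snd, smul_eq_mul, zpow_mul, zpow_natCast, ha₁, ha₂,
    hb, hb₂, hz, ← central_add]
  congr 2
  simp [powLin]

variable {p}

/-- Reduction modulo `p` of quadruples of integers. -/
def red (v : Quad ℤ) : Quad (ZMod p) := (v.1, v.2.1, v.2.2.1, v.2.2.2)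

lemma red_eq_red {v w : Quad ℤ} : red (p := p) v = red w ↔ ∃ u, w = v + (p : ℤ) • u := by
  constructor
  · intro h
    simp only [red, Prod.ext_iff, ZMod.intCast_eq_intCast_iff_dvd_sub] at h
    obtain ⟨⟨a, ha⟩, ⟨b, hb⟩, ⟨c, hc⟩, ⟨d, hd⟩⟩ := h
    refine ⟨(a, b, c, d), ?_⟩
    simp only [Prod.ext_iff, Prod.fst_add, Prod.snd_add, Prod.smul_fst, Prod.smul_snd, smul_eq_mul]
    omega
  · rintro ⟨u, rfl⟩
    simp [red]

lemma red_commForm (v w : Quad ℤ) :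
    red (p := p) (commForm v w) = commForm (red v) (red w) := by
  simp [red, commForm, tens]

lemma red_powForm (v : Quad ℤ) :
    red (p := p) (powForm (p.choose 2 : ℤ) v) = powForm (p.choose 2 : ZMod p) (red v) := by
  simp [red, powForm, tens, powLin]

lemma red_surjective (v : Quad (ZMod p)) : ∃ w : Quad ℤ, red w = v :=
  ⟨(v.1.cast, v.2.1.cast, v.2.2.1.cast, v.2.2.2.cast), by simp [red]⟩

lemma red_add (v w : Quad ℤ) : red (p := p) (v + w) = red v + red w := by
  simp [red]

lemma central_congr {z w : Quad ℤ} (h : red (p := p) z = red w) : central p z = central p w := by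
  obtain ⟨u, rfl⟩ := red_eq_red.1 h
  rw [central_add, central_smul, mul_one]

/-- The lower bound on the size of the centre. An equality in `G` passes to the model, where an
element of `powSubgroup p` with zero first component has central coordinate divisible by `p`. -/
lemma central_eq_central [Fact p.Prime] {z w : Quad ℤ} :
    central p z = central p w ↔ red (p := p) z = red w := by
  refine ⟨fun h => ?_, central_congr⟩
  have h1 := congrArg (toModel p) h
  rw [central, central, toModel_ofHeis, toModel_ofHeis, QuotientGroup.eq] at h1
  obtain ⟨u, y, h2⟩ := h1
  have hv := congrArg Heis.v h2
  have hz := congrArg Heis.z h2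
  have hp : (p : ℤ) ≠ 0 := by exact_mod_cast (Fact.out (p := p.Prime)).ne_zero
  have hv' : (p : ℤ) • u = 0 := by
    change _ = (p : ℤ) • u at hv
    rw [← hv]; simp
  have hu : u = 0 := (smul_eq_zero.1 hv').resolve_left hp
  subst hu
  refine red_eq_red.2 ⟨y, ?_⟩
  simp only [Prod.ext_iff] at hz ⊢
  simp [powLin, tens] at hz ⊢
  omega

lemma pow_ofHeis (g : Heis ℤ) :
    ofHeis p g ^ p = central p (powForm (p.choose 2 : ℤ) g.v) := by
  rw [← map_pow, Heis.pow_eq, ← natCast_zsmul, ofHeis_smul]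
  apply central_congr
  refine red_eq_red.2 ⟨-g.z, ?_⟩
  ext <;> simp [powForm, powLin, tens] <;> ring

/-! ### The central quotient and the relations read in it -/

variable (p)

/-- The projection of the JK-group to its quotient by the centre. -/
def proj : JKGroup p (1, 0) →* Multiplicative (Quad (ZMod p)) :=
  lift (f := fun s => .ofAdd (red (heisGen s).v))
    (fun x y z => commutatorElement_eq_one_iff_commute.2 (Commute.all _ _)) <| by
  have h : ∀ v : Multiplicative (Quad (ZMod p)), v ^ p = 1 := by
    intro v
    apply Multiplicative.toAdd.injective
    rw [toAdd_pow, toAdd_one]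
    ext <;> simp
  have h' : ∀ v w : Multiplicative (Quad (ZMod p)), ⁅v, w⁆ = 1 :=
    fun v w => commutatorElement_eq_one_iff_commute.2 (Commute.all _ _)
  constructor <;> simp only [h, h']

/-- The projection of the JK-group to its quotient by the centre, in additive notation. -/
def coord (g : JKGroup p (1, 0)) : Quad (ZMod p) := (proj p g).toAdd

variable {p}

@[simp] lemma coord_mul (g h : JKGroup p (1, 0)) : coord p (g * h) = coord p g + coord p h := by
  simp [coord]

@[simp] lemma coord_one : coord p 1 = 0 := by simp [coord]

@[simp] lemma coord_inv (g : JKGroup p (1, 0)) : coord p g⁻¹ = -coord p g := by simp [coord]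

@[simp] lemma coord_pow (g : JKGroup p (1, 0)) (n : ℕ) : coord p (g ^ n) = n • coord p g := by
  simp [coord]

@[simp] lemma coord_gen (s : JKGen) : coord p (gen p s) = red (heisGen s).v := by
  simp [coord, proj, gen]

lemma coord_ofHeis (h : Heis ℤ) : coord p (ofHeis p h) = red h.v := by
  have h' : ∀ x y : JKGroup p (1, 0), proj p ⁅x, y⁆ = 1 := fun x y => by
    rw [map_commutatorElement]; exact commutatorElement_eq_one_iff_commute.2 (Commute.all _ _)
  have hg : ∀ s, proj p (gen p s) = .ofAdd (red (heisGen s).v) := fun s => lift_of _ _ s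
  simp only [coord, ofHeis, HeisGens.toHom_apply, HeisGens.prodA, HeisGens.prodB, HeisGens.prodC,
    heisGens, map_mul, map_zpow, h', hg]
  simp [heisGen, red]

/-- Both sides of every relation are central elements given by forms in the classes modulo the
centre, and `central_eq_central` compares them modulo `p`. -/
lemma jkRel_iff [Fact p.Prime] (t : JKGen → JKGroup p (1, 0)) :
    JKRel p t ↔ IsSol (p.choose 2 : ZMod p) (coord p (t .a₁)) (coord p (t .a₂))
      (coord p (t .b₁)) (coord p (t .b₂)) := by
  choose h ht using fun s => ofHeis_surjective p (t s)
  have h1 : central p 0 = 1 := map_one (ofHeis p)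
  have key : JKRel p t ↔ JKRel p fun s => ofHeis p (h s) := by simp only [ht]
  rw [key]
  simp only [← ht, coord_ofHeis]
  have h0 : red (p := p) 0 = 0 := by simp [red]
  constructor
  · rintro ⟨r1, r2, r3, r4, r5, r6⟩
    rw [← map_mul] at r3
    rw [← h1] at r5 r6
    rw [commutator_ofHeis] at r1 r2 r3 r4 r5 r6
    rw [pow_ofHeis] at r1 r2 r3 r4
    rw [central_eq_central, red_commForm] at r1 r2 r3 r4 r5 r6
    rw [red_powForm] at r1 r2 r3 r4
    rw [h0] at r5 r6
    rw [Heis.mul_v, red_add] at r3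
    exact ⟨r1, r2, r3, r4, r5, r6⟩
  · rintro ⟨r1, r2, r3, r4, r5, r6⟩
    constructor
    · rwa [commutator_ofHeis, pow_ofHeis, central_eq_central, red_commForm, red_powForm]
    · rwa [commutator_ofHeis, pow_ofHeis, central_eq_central, red_commForm, red_powForm]
    · rwa [← map_mul, commutator_ofHeis, pow_ofHeis, central_eq_central, red_commForm, red_powForm,
        Heis.mul_v, red_add]
    · rwa [commutator_ofHeis, pow_ofHeis, central_eq_central, red_commForm, red_powForm]
    · rwa [← h1, commutator_ofHeis, central_eq_central, red_commForm, h0]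
    · rwa [← h1, commutator_ofHeis, central_eq_central, red_commForm, h0]

lemma coord_central (z : Quad ℤ) : coord p (central p z) = 0 := by
  rw [central, coord_ofHeis]; simp [red]

lemma exists_central_of_coord_eq_zero {g : JKGroup p (1, 0)} (h : coord p g = 0) :
    ∃ z, central p z = g := by
  obtain ⟨h', rfl⟩ := ofHeis_surjective p g
  rw [coord_ofHeis, show (0 : Quad (ZMod p)) = red 0 by simp [red]; rfl, eq_comm, red_eq_red] at h
  obtain ⟨u, hu⟩ := h
  refine ⟨powLin u + h'.z, ?_⟩
  rw [← ofHeis_smul, ← zero_add ((p : ℤ) • u), ← hu]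

lemma coord_surjective (v : Quad (ZMod p)) : ∃ g, coord p g = v := by
  obtain ⟨w, rfl⟩ := red_surjective v
  exact ⟨ofHeis p ⟨w, 0⟩, coord_ofHeis _⟩

lemma card_quad : Nat.card (Quad (ZMod p)) = p ^ 4 := by
  simp only [Quad, Nat.card_prod, Nat.card_zmod]; ring

/-- The fibres of the projection to the central quotient are in bijection with the centre. -/
lemma card_coord_fiber [Fact p.Prime] (v : Quad (ZMod p)) :
    Nat.card {g // coord p g = v} = p ^ 4 := by
  obtain ⟨g₀, rfl⟩ := coord_surjective v
  rw [← card_quad (p := p)]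
  choose f hf using red_surjective (p := p)
  symm
  refine Nat.card_congr (Equiv.ofBijective
    (fun z => ⟨g₀ * central p (f z), by simp [coord_central]⟩) ⟨?_, ?_⟩)
  · intro z w h
    simp only [Subtype.mk.injEq, mul_right_inj, central_eq_central, hf] at h
    exact h
  · rintro ⟨g, hg⟩
    obtain ⟨z, hz⟩ := exists_central_of_coord_eq_zero (p := p) (g := g₀⁻¹ * g) (by simp [hg])
    refine ⟨red z, Subtype.ext ?_⟩
    change g₀ * central p (f (red z)) = g
    rw [central_congr (hf (red z)), hz, mul_inv_cancel_left]

instance [Fact p.Prime] : Finite (JKGroup p (1, 0)) := by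
  have : ∀ v : Quad (ZMod p), Finite {g // coord p g = v} := fun v =>
    Nat.finite_of_card_ne_zero (by
      rw [card_coord_fiber]; exact pow_ne_zero _ (Fact.out (p := p.Prime)).ne_zero)
  exact Finite.of_equiv _ (Equiv.sigmaFiberEquiv (coord p))

end JKGroup

/-! ### Counting orbits of a given length -/

namespace MulAction

/-- The elements of a finite `G`-set lying in orbits of length `n` are counted by the orbits. -/
lemma ncard_orbit_eq_mul (G X : Type) [Group G] [MulAction G X] [Finite X] (n : ℕ) :
    Set.ncard {x : X | (orbit G x).ncard = n} =
      Set.ncard {o : orbitRel.Quotient G X | o.orbit.ncard = n} * n := by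
  have e : (Σ y : {o : orbitRel.Quotient G X // o.orbit.ncard = n},
      {x : X // (Quotient.mk'' x : orbitRel.Quotient G X) = y}) ≃
      {x : X // (orbit G x).ncard = n} :=
    Equiv.sigmaSubtypeFiberEquivSubtype
      (fun x : X => (Quotient.mk'' x : orbitRel.Quotient G X)) fun x => by
        rw [orbitRel.Quotient.orbit_mk]
  have hfin : Finite (orbitRel.Quotient G X) := Quotient.finite _
  have : Fintype {o : orbitRel.Quotient G X // o.orbit.ncard = n} := Fintype.ofFinite _
  rw [← Nat.card_coe_set_eq, ← Nat.card_coe_set_eq]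
  change Nat.card {x : X // (orbit G x).ncard = n} = _
  rw [← Nat.card_congr e, Nat.card_sigma,
    Finset.sum_const_nat (m := n), Finset.card_univ, ← Nat.card_eq_fintype_card]
  · rfl
  · rintro ⟨o, ho⟩ -
    refine Eq.trans ?_ ((Nat.card_coe_set_eq _).trans ho)
    exact Nat.card_congr (Equiv.subtypeEquivRight fun x => orbitRel.Quotient.mem_orbit.symm)

end MulAction

/-! ### The two kinds of endomorphisms -/

namespace JKGroup

variable {p : ℕ}

lemma kerLine_zero {R : Type} [CommRing R] : kerLine (0 : R) = 0 := by
  simp [kerLine]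

lemma kerLine_injective : Function.Injective (kerLine (R := ZMod p)) :=
  fun _ _ h => congrArg Prod.fst h

lemma jkRel_comp_gen (φ : Monoid.End (JKGroup p (1, 0))) : JKRel p fun s => φ (gen p s) := by
  obtain ⟨h1, h2, h3, h4, h5, h6⟩ := jkRel_gen p
  constructor
  · rw [← map_pow, h1, map_commutatorElement]
  · rw [← map_pow, h2, map_commutatorElement]
  · rw [← map_pow, h3, map_commutatorElement, map_mul]
  · rw [← map_pow, h4, map_commutatorElement]
  · rw [← map_commutatorElement, h5, map_one]
  · rw [← map_commutatorElement, h6, map_one]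

lemma map_central {φ : Monoid.End (JKGroup p (1, 0))}
    (h : ∀ x y : JKGroup p (1, 0), φ ⁅x, y⁆ = ⁅x, y⁆) (z : Quad ℤ) :
    φ (central p z) = central p z := by
  simp only [central_eq, HeisGens.prodC, map_mul, map_zpow, h]

lemma map_central_eq_one {φ : Monoid.End (JKGroup p (1, 0))}
    (h : ∀ x y : JKGroup p (1, 0), φ ⁅x, y⁆ = 1)
    (z : Quad ℤ) : φ (central p z) = 1 := by
  simp only [central_eq, HeisGens.prodC, map_mul, map_zpow, h, one_zpow, mul_one]

lemma commutator_congr {x x' y y' : JKGroup p (1, 0)}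
    (h : commForm (coord p x) (coord p y) = commForm (coord p x') (coord p y')) :
    ⁅x, y⁆ = ⁅x', y'⁆ := by
  obtain ⟨x, rfl⟩ := ofHeis_surjective p x
  obtain ⟨y, rfl⟩ := ofHeis_surjective p y
  obtain ⟨x', rfl⟩ := ofHeis_surjective p x'
  obtain ⟨y', rfl⟩ := ofHeis_surjective p y'
  simp only [coord_ofHeis, ← red_commForm] at h
  rw [commutator_ofHeis, commutator_ofHeis]
  exact central_congr h

lemma exists_eq_mul_central {x y : JKGroup p (1, 0)} (h : coord p x = coord p y) :
    ∃ z, y = x * central p z := by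
  obtain ⟨z, hz⟩ := exists_central_of_coord_eq_zero (p := p) (g := x⁻¹ * y) (by simp [h])
  exact ⟨z, by rw [hz, mul_inv_cancel_left]⟩

lemma coe_smul {φ : Monoid.End (JKGroup p (1, 0))} (σ : (Monoid.End (JKGroup p (1, 0)))ˣ)
    (g : JKGroup p (1, 0)) :
    (ConjAct.toConjAct σ • φ) g =
      (σ : Monoid.End (JKGroup p (1, 0))) (φ ((↑σ⁻¹ : Monoid.End (JKGroup p (1, 0))) g)) := rfl

lemma ncard_orbit_eq_one {φ : Monoid.End (JKGroup p (1, 0))}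
    (h : ∀ σ : (Monoid.End (JKGroup p (1, 0)))ˣ,
    ConjAct.toConjAct σ • φ = φ) :
    (MulAction.orbit (ConjAct (Monoid.End (JKGroup p (1, 0)))ˣ) φ).ncard = 1 := by
  rw [Set.ncard_eq_one]
  refine ⟨φ, Set.eq_singleton_iff_unique_mem.2 ⟨MulAction.mem_orbit_self φ, ?_⟩⟩
  rintro _ ⟨σ, rfl⟩
  exact h (ConjAct.ofConjAct σ)

/-- Endomorphisms inducing the identity on the central quotient. -/
def IsIdModCenter (φ : Monoid.End (JKGroup p (1, 0))) : Prop :=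
  ∀ g, coord p (φ g) = coord p g

/-- Endomorphisms whose image modulo the centre lies in the line of elements of order `p`. -/
def IsLine (φ : Monoid.End (JKGroup p (1, 0))) : Prop :=
  ∀ g, coord p (φ g) ∈ Set.range (kerLine (R := ZMod p))

/-- Endomorphisms with central image. -/
def IsCentral (φ : Monoid.End (JKGroup p (1, 0))) : Prop :=
  ∀ g, coord p (φ g) = 0

variable (p) in
/-- The subgroup of elements whose image modulo the centre lies in the line of elements of
order `p`. -/
def lineSubgroup : Subgroup (JKGroup p (1, 0)) where
  carrier := {g | coord p g ∈ Set.range (kerLine (R := ZMod p))}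
  one_mem' := ⟨0, by simp [kerLine]⟩
  mul_mem' := by
    rintro x y ⟨a, ha⟩ ⟨b, hb⟩
    refine ⟨a + b, ?_⟩
    rw [coord_mul, ← ha, ← hb]; ext <;> simp [kerLine]; ring
  inv_mem' := by
    rintro x ⟨a, ha⟩
    refine ⟨-a, ?_⟩
    rw [coord_inv, ← ha]; ext <;> simp [kerLine]

lemma isIdModCenter_iff {φ : Monoid.End (JKGroup p (1, 0))} :
    IsIdModCenter φ ↔ ∀ s, coord p (φ (gen p s)) ∈ ({coord p (gen p s)} : Set _) := by
  refine ⟨fun h s => h _, fun h g => ?_⟩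
  have : (proj p).comp φ = proj p := PresentedGroup.ext fun s => h s
  exact congrArg Multiplicative.toAdd (DFunLike.congr_fun this g)

lemma isLine_iff {φ : Monoid.End (JKGroup p (1, 0))} :
    IsLine φ ↔ ∀ s, coord p (φ (gen p s)) ∈ Set.range (kerLine (R := ZMod p)) :=
  ⟨fun h _ => h _, fun h g =>
    PresentedGroup.generated_by _ ((lineSubgroup p).comap (φ : _ →* _)) h g⟩

lemma isCentral_iff {φ : Monoid.End (JKGroup p (1, 0))} :
    IsCentral φ ↔ ∀ s, coord p (φ (gen p s)) ∈ ({0} : Set _) := by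
  refine ⟨fun h s => h _, fun h g => ?_⟩
  have : (proj p).comp φ = 1 := PresentedGroup.ext fun s => h s
  exact congrArg Multiplicative.toAdd (DFunLike.congr_fun this g)

lemma IsCentral.isLine {φ : Monoid.End (JKGroup p (1, 0))} (h : IsCentral φ) : IsLine φ :=
  fun g => ⟨0, by rw [h g]; simp [kerLine]⟩

/-- The endomorphism with prescribed images of the generators. -/
def endOfTuple (t : JKGen → JKGroup p (1, 0)) (ht : JKRel p t) : Monoid.End (JKGroup p (1, 0)) :=
  lift class_two ht

lemma endOfTuple_gen {t : JKGen → JKGroup p (1, 0)} (ht : JKRel p t) (s : JKGen) :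
    endOfTuple t ht (gen p s) = t s := lift_of _ ht s

/-- Functions on the set of generators as quadruples. -/
def _root_.JKGen.piEquiv (X : JKGen → Type) :
    ((s : JKGen) → X s) ≃ X .a₁ × X .a₂ × X .b₁ × X .b₂ where
  toFun f := (f _, f _, f _, f _)
  invFun t s := match s with
    | .a₁ => t.1
    | .a₂ => t.2.1
    | .b₁ => t.2.2.1
    | .b₂ => t.2.2.2
  left_inv f := by funext s; cases s <;> rfl
  right_inv _ := rfl

lemma IsIdModCenter.apply_central {φ : Monoid.End (JKGroup p (1, 0))}
    (h : IsIdModCenter φ) (z : Quad ℤ) :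
    φ (central p z) = central p z :=
  map_central (fun x y => by
    rw [map_commutatorElement]; exact commutator_congr (by rw [h, h])) z

/-- Each map multiplies `g` by a central element, and each fixes central elements, so both
composites multiply `g` by the two central factors. -/
lemma IsIdModCenter.commute {φ σ : Monoid.End (JKGroup p (1, 0))} (h : IsIdModCenter φ)
    (h' : IsIdModCenter σ) (g : JKGroup p (1, 0)) :
    σ (φ g) = φ (σ g) := by
  obtain ⟨z, hz⟩ := exists_eq_mul_central (h g).symm
  obtain ⟨w, hw⟩ := exists_eq_mul_central (h' g).symm
  rw [hz, map_mul, h'.apply_central, hw, map_mul, h.apply_central, hz, mul_assoc, mul_assoc,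
    (central_commute p z _).eq]

variable [Fact p.Prime]

lemma isIdModCenter_or_isLine (φ : Monoid.End (JKGroup p (1, 0))) :
    IsIdModCenter φ ∨ IsLine φ := by
  rw [isIdModCenter_iff, isLine_iff]
  rcases ((jkRel_iff _).1 (jkRel_comp_gen φ)).classify with ⟨h1, h2, h3, h4⟩ | ⟨h1, h2, h3, h4⟩
  · left
    rintro (_ | _ | _ | _) <;> simp only [h1, h2, h3, h4, coord_gen] <;> simp [red, heisGen]
  · right
    rintro (_ | _ | _ | _)
    exacts [⟨_, h1.symm⟩, ⟨_, h2.symm⟩, ⟨_, h3.symm⟩, ⟨_, h4.symm⟩]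

/-! ### Counting endomorphisms -/

lemma card_coord_mem (A : Set (Quad (ZMod p))) :
    Nat.card {g // coord p g ∈ A} = A.ncard * p ^ 4 := by
  rw [← Nat.card_congr (Equiv.sigmaSubtypeFiberEquivSubtype (coord p)
    (p := fun g => coord p g ∈ A) (q := fun v => v ∈ A) fun _ => Iff.rfl)]
  have : Finite (Quad (ZMod p)) := inferInstance
  have : Fintype {v // v ∈ A} := Fintype.ofFinite _
  rw [Nat.card_sigma, Finset.sum_const_nat (m := p ^ 4) fun v _ => card_coord_fiber _,
    Finset.card_univ, ← Nat.card_eq_fintype_card]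
  rfl

/-- Endomorphisms with prescribed images modulo the centre correspond to lifts of these. -/
def endEquiv (A : JKGen → Set (Quad (ZMod p)))
    (h : ∀ a ∈ A .a₁, ∀ b ∈ A .a₂, ∀ c ∈ A .b₁, ∀ d ∈ A .b₂,
      IsSol (p.choose 2 : ZMod p) a b c d) :
    {φ : Monoid.End (JKGroup p (1, 0)) // ∀ s, coord p (φ (gen p s)) ∈ A s} ≃
    ((s : JKGen) → {g // coord p g ∈ A s}) where
  toFun φ s := ⟨_, φ.2 s⟩
  invFun t := ⟨endOfTuple (fun s => (t s).1)
    ((jkRel_iff _).2 (h _ (t _).2 _ (t _).2 _ (t _).2 _ (t _).2)), fun s => by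
      rw [endOfTuple_gen]; exact (t s).2⟩
  left_inv φ := Subtype.ext <| PresentedGroup.ext fun s => endOfTuple_gen (jkRel_comp_gen _) s
  right_inv t := funext fun s => Subtype.ext (endOfTuple_gen (t := fun s => (t s).1)
    ((jkRel_iff _).2 (h _ (t _).2 _ (t _).2 _ (t _).2 _ (t _).2)) s)

lemma ncard_end (A : JKGen → Set (Quad (ZMod p)))
    (h : ∀ a ∈ A .a₁, ∀ b ∈ A .a₂, ∀ c ∈ A .b₁, ∀ d ∈ A .b₂,
      IsSol (p.choose 2 : ZMod p) a b c d) {n : ℕ} (hn : ∀ s, (A s).ncard = n) :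
    Set.ncard {φ : Monoid.End (JKGroup p (1, 0)) | ∀ s, coord p (φ (gen p s)) ∈ A s} =
      n ^ 4 * p ^ 16 := by
  rw [← Nat.card_coe_set_eq]
  refine (Nat.card_congr ((endEquiv A h).trans (JKGen.piEquiv _))).trans ?_
  simp only [Nat.card_prod, card_coord_mem, hn]
  ring

lemma ncard_isLine : Set.ncard {φ : Monoid.End (JKGroup p (1, 0)) | IsLine φ} = p ^ 20 := by
  simp only [isLine_iff]
  rw [ncard_end (fun _ => Set.range kerLine) (n := p)]
  · ring
  · rintro _ ⟨a, rfl⟩ _ ⟨b, rfl⟩ _ ⟨c, rfl⟩ _ ⟨d, rfl⟩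
    exact isSol_kerLine _ _ _ _ _
  · intro _
    rw [← Set.image_univ, Set.ncard_image_of_injective _ kerLine_injective, Set.ncard_univ,
      Nat.card_zmod]

lemma ncard_isCentral : Set.ncard {φ : Monoid.End (JKGroup p (1, 0)) | IsCentral φ} = p ^ 16 := by
  simp only [isCentral_iff]
  rw [ncard_end (fun _ => {0}) (n := 1) _ fun _ => Set.ncard_singleton _]
  · ring
  · rintro _ rfl _ rfl _ rfl _ rfl
    simpa only [kerLine_zero] using isSol_kerLine (p.choose 2 : ZMod p) 0 0 0 0

lemma ncard_isIdModCenter :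
    Set.ncard {φ : Monoid.End (JKGroup p (1, 0)) | IsIdModCenter φ} = p ^ 16 := by
  simp only [isIdModCenter_iff]
  rw [ncard_end (fun s => {coord p (gen p s)}) (n := 1) _ fun _ => Set.ncard_singleton _]
  · ring
  · rintro _ rfl _ rfl _ rfl _ rfl
    exact (jkRel_iff (gen p)).1 (jkRel_gen p)

/-! ### The action of automorphisms -/

variable {φ σ : Monoid.End (JKGroup p (1, 0))}

/-- `commForm` vanishes on the line, so `φ` kills all commutators, and these generate the image of
`central`. -/
lemma IsLine.apply_central (h : IsLine φ) (z : Quad ℤ) : φ (central p z) = 1 :=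
  map_central_eq_one (fun x y => by
    obtain ⟨a, ha⟩ := h x
    obtain ⟨b, hb⟩ := h y
    rw [map_commutatorElement, ← commutatorElement_one_right (1 : JKGroup p (1, 0))]
    refine commutator_congr ?_
    rw [← ha, ← hb]
    simp [commForm, tens, kerLine]) z

/-- The other kind kills the nontrivial element `central p (1, 0, 0, 0)`, so it is not injective. -/
lemma isIdModCenter_of_unit (σ : (Monoid.End (JKGroup p (1, 0)))ˣ) :
    IsIdModCenter (σ : Monoid.End (JKGroup p (1, 0))) := by
  refine (isIdModCenter_or_isLine _).resolve_right fun h => ?_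
  have h1 := h.apply_central (1, 0, 0, 0)
  have h2 : (↑σ⁻¹ : Monoid.End (JKGroup p (1, 0))) (σ.1 (central p (1, 0, 0, 0))) =
      central p (1, 0, 0, 0) := DFunLike.congr_fun σ.inv_mul _
  rw [h1, map_one, ← map_one (ofHeis p)] at h2
  have h3 := congrArg Prod.fst (central_eq_central.1 (show central p 0 = _ from h2))
  simp [red] at h3

lemma IsIdModCenter.exists_unit (h : IsIdModCenter φ) :
    ∃ σ : (Monoid.End (JKGroup p (1, 0)))ˣ, (σ : Monoid.End (JKGroup p (1, 0))) = φ := by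
  have hinj : Function.Injective φ := by
    refine (injective_iff_map_eq_one φ).2 fun g hg => ?_
    have h0 : coord p g = 0 := by rw [← h g, hg, coord_one]
    obtain ⟨z, rfl⟩ := exists_central_of_coord_eq_zero h0
    rwa [h.apply_central] at hg
  let e := MulEquiv.ofBijective (φ : _ →* _) (Finite.injective_iff_bijective.1 hinj)
  exact ⟨⟨φ, (e.symm : _ →* _), Monoid.End.ext _ fun x => e.apply_symm_apply x,
    Monoid.End.ext _ fun x => e.symm_apply_apply x⟩, rfl⟩

/-- `σ⁻¹` moves `g` by a central factor, which `φ` kills. -/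
lemma IsLine.smul_apply (h : IsLine φ) (σ : (Monoid.End (JKGroup p (1, 0)))ˣ)
    (g : JKGroup p (1, 0)) :
    (ConjAct.toConjAct σ • φ) g = (σ : Monoid.End (JKGroup p (1, 0))) (φ g) := by
  obtain ⟨z, hz⟩ := exists_eq_mul_central (isIdModCenter_of_unit σ⁻¹ g).symm
  rw [coe_smul, hz, map_mul, h.apply_central, mul_one]

lemma IsCentral.smul_eq (h : IsCentral φ) (σ : (Monoid.End (JKGroup p (1, 0)))ˣ) :
    ConjAct.toConjAct σ • φ = φ := by
  refine Monoid.End.ext _ fun g => ?_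
  obtain ⟨z, hz⟩ := exists_central_of_coord_eq_zero (h g)
  rw [h.isLine.smul_apply, ← hz, (isIdModCenter_of_unit σ).apply_central]

lemma IsIdModCenter.smul_eq (h : IsIdModCenter φ) (σ : (Monoid.End (JKGroup p (1, 0)))ˣ) :
    ConjAct.toConjAct σ • φ = φ := by
  refine Monoid.End.ext _ fun g => ?_
  rw [coe_smul, h.commute (isIdModCenter_of_unit σ)]
  exact congrArg φ (DFunLike.congr_fun σ.mul_inv g)

/-- The central automorphism attached to the first coordinate, a scalar and a central element. -/
def centralAut (m : ZMod p) (z : Quad ℤ) : Monoid.End (JKGroup p (1, 0)) :=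
  MonoidHom.mk' (fun g => g * central p (((m * (coord p g).1).cast : ℤ) • z)) <| by
    intro x y
    have : central p (((m * (coord p (x * y)).1).cast : ℤ) • z) =
        central p (((m * (coord p x).1).cast : ℤ) • z) *
        central p (((m * (coord p y).1).cast : ℤ) • z) := by
      rw [← central_add]
      apply central_congr
      simp [red]
      refine ⟨?_, ?_, ?_, ?_⟩ <;> ring
    rw [this, mul_assoc, mul_assoc, ← mul_assoc (central p _) y, (central_commute p _ y).eq,
      mul_assoc]

lemma centralAut_apply (m : ZMod p) (z : Quad ℤ) (g : JKGroup p (1, 0)) :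
    centralAut m z g = g * central p (((m * (coord p g).1).cast : ℤ) • z) := rfl

lemma isIdModCenter_centralAut (m : ZMod p) (z : Quad ℤ) : IsIdModCenter (centralAut m z) := by
  intro g
  rw [centralAut_apply, coord_mul, coord_central, add_zero]

/-- Evaluation at an element `g₀` with `φ g₀` noncentral maps the orbit bijectively onto the coset
of `φ g₀` modulo the centre. -/
lemma IsLine.ncard_orbit (h : IsLine φ) (h0 : ¬ IsCentral φ) :
    (MulAction.orbit (ConjAct (Monoid.End (JKGroup p (1, 0)))ˣ) φ).ncard = p ^ 4 := by
  obtain ⟨g₀, hg₀⟩ := not_forall.1 h0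
  obtain ⟨f₀, hf₀⟩ := h g₀
  have hf : f₀ ≠ 0 := by
    rintro rfl
    exact hg₀ (by rw [← hf₀]; simp [kerLine])
  have hinj : Set.InjOn (fun ψ : Monoid.End (JKGroup p (1, 0)) => ψ g₀)
      (MulAction.orbit (ConjAct (Monoid.End (JKGroup p (1, 0)))ˣ) φ) := by
    rintro _ ⟨σ, rfl⟩ _ ⟨τ, rfl⟩ hστ
    refine Monoid.End.ext _ fun g => ?_
    have h1 := h.smul_apply (ConjAct.ofConjAct σ)
    have h2 := h.smul_apply (ConjAct.ofConjAct τ)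
    simp only [ConjAct.toConjAct_ofConjAct] at h1 h2 hστ ⊢
    rw [h1, h2] at hστ ⊢
    obtain ⟨f, hf'⟩ := h g
    -- The line is spanned by the class of `φ g₀`, so `φ g` is a power of `φ g₀` times a central
    -- element, which units fix.
    obtain ⟨z, hz⟩ := exists_eq_mul_central (p := p) (x := φ g₀ ^ (f / f₀).val) (y := φ g) <| by
      rw [coord_pow, ← hf₀, ← hf', ← Nat.cast_smul_eq_nsmul (ZMod p), ZMod.natCast_zmod_val]
      ext <;> simp [kerLine, hf]
    rw [hz, map_mul, map_mul, map_pow, map_pow, hστ, (isIdModCenter_of_unit _).apply_central,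
      (isIdModCenter_of_unit _).apply_central]
  have himage : (fun ψ : Monoid.End (JKGroup p (1, 0)) => ψ g₀) ''
      (MulAction.orbit (ConjAct (Monoid.End (JKGroup p (1, 0)))ˣ) φ) =
      {g | coord p g = coord p (φ g₀)} := by
    ext g
    constructor
    · rintro ⟨_, ⟨σ, rfl⟩, rfl⟩
      have h1 := h.smul_apply (ConjAct.ofConjAct σ) g₀
      simp only [ConjAct.toConjAct_ofConjAct] at h1
      change coord p ((σ • φ) g₀) = _
      rw [h1, isIdModCenter_of_unit]
    · intro hg
      obtain ⟨z, rfl⟩ := exists_eq_mul_central (Eq.symm hg)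
      -- The first coordinate of `φ g₀` is `f₀`, so the scalar `f₀⁻¹` makes this automorphism
      -- multiply `φ g₀` by exactly `central p z`.
      obtain ⟨σ, hσ⟩ := (isIdModCenter_centralAut f₀⁻¹ z).exists_unit
      refine ⟨_, ⟨ConjAct.toConjAct σ, rfl⟩, ?_⟩
      change (ConjAct.toConjAct σ • φ) g₀ = _
      rw [h.smul_apply, hσ, centralAut_apply, ← hf₀]
      congr 1
      apply central_congr
      simp [kerLine, hf, red]
  rw [← hinj.ncard_image, himage, ← card_coord_fiber (coord p (φ g₀)),
    ← Nat.card_coe_set_eq]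
  rfl

end JKGroup

/-! ### The orbit count -/

open JKGroup in
theorem corollary5p4 (p : ℕ) (hp : p.Prime) :
    Nat.card (ConjOrbit (JKGroup p (1, 0))) = 3 * p ^ 16 - p ^ 12 ∧
    Set.ncard {o : ConjOrbit (JKGroup p (1, 0)) | Set.ncard o.orbit = 1} = 2 * p ^ 16 ∧
    Set.ncard {o : ConjOrbit (JKGroup p (1, 0)) | Set.ncard o.orbit = p ^ 4} =
      p ^ 12 * (p ^ 4 - 1) := by
  have : Fact p.Prime := ⟨hp⟩
  have hfin : Finite (Monoid.End (JKGroup p (1, 0))) := DFunLike.finite _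
  have hp4 : 1 < p ^ 4 := Nat.one_lt_pow (by norm_num) hp.one_lt
  have hid : ∀ φ : Monoid.End (JKGroup p (1, 0)), IsIdModCenter φ → ¬ IsLine φ := by
    rintro φ h1 h2
    obtain ⟨f, hf⟩ := h2 (gen p .b₁)
    rw [h1, coord_gen] at hf
    simpa [red, heisGen, kerLine] using congrArg (fun v => v.2.2.1) hf
  have h1 : {φ : Monoid.End (JKGroup p (1, 0)) |
      (MulAction.orbit (ConjAct (Monoid.End (JKGroup p (1, 0)))ˣ) φ).ncard = 1} =
      {φ | IsIdModCenter φ} ∪ {φ | IsCentral φ} := by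
    ext φ
    constructor
    · intro h
      rcases isIdModCenter_or_isLine φ with h' | h'
      · exact Or.inl h'
      · refine Or.inr (not_not.1 fun h0 => ?_)
        rw [Set.mem_ofPred_eq, h'.ncard_orbit h0] at h
        omega
    · rintro (h | h)
      · exact ncard_orbit_eq_one (IsIdModCenter.smul_eq h)
      · exact ncard_orbit_eq_one (IsCentral.smul_eq h)
  have h2 : {φ : Monoid.End (JKGroup p (1, 0)) |
      (MulAction.orbit (ConjAct (Monoid.End (JKGroup p (1, 0)))ˣ) φ).ncard = p ^ 4} =
      {φ | IsLine φ} \ {φ | IsCentral φ} := by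
    ext φ
    constructor
    · intro h
      have h' : ¬ (IsIdModCenter φ ∨ IsCentral φ) := fun h' => by
        have : φ ∈ {φ | IsIdModCenter φ} ∪ {φ | IsCentral φ} := h'
        rw [← h1, Set.mem_ofPred_eq] at this
        rw [Set.mem_ofPred_eq, this] at h
        omega
      exact ⟨(isIdModCenter_or_isLine φ).resolve_left fun k => h' (Or.inl k),
        fun k => h' (Or.inr k)⟩
    · rintro ⟨h, h'⟩
      exact IsLine.ncard_orbit h h'
  have c1 := MulAction.ncard_orbit_eq_mul (ConjAct (Monoid.End (JKGroup p (1, 0)))ˣ)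
    (Monoid.End (JKGroup p (1, 0))) 1
  have c2 := MulAction.ncard_orbit_eq_mul (ConjAct (Monoid.End (JKGroup p (1, 0)))ˣ)
    (Monoid.End (JKGroup p (1, 0))) (p ^ 4)
  rw [h1, Set.ncard_union_eq, ncard_isIdModCenter, ncard_isCentral, mul_one, ← two_mul] at c1
  swap
  · exact Set.disjoint_left.2 fun φ k k' => hid φ k (IsCentral.isLine k')
  rw [h2, Set.ncard_sdiff (show {φ : Monoid.End (JKGroup p (1, 0)) | IsCentral φ} ⊆
    {φ | IsLine φ} from fun φ k => IsCentral.isLine k), ncard_isLine, ncard_isCentral] at c2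
  have c2' : Set.ncard {o : ConjOrbit (JKGroup p (1, 0)) | Set.ncard o.orbit = p ^ 4} =
      p ^ 12 * (p ^ 4 - 1) := by
    -- The `p ^ 20 - p ^ 16` noncentral endomorphisms of line type fall into orbits of length `p ^
    -- 4`.
    refine Nat.eq_of_mul_eq_mul_right (by omega : 0 < p ^ 4) (c2.symm.trans ?_)
    rw [Nat.mul_sub_one, Nat.sub_mul]
    ring_nf
  refine ⟨?_, c1.symm, c2'⟩
  have hO : Finite (ConjOrbit (JKGroup p (1, 0))) := Quotient.finite _
  have hu : (Set.univ : Set (ConjOrbit (JKGroup p (1, 0)))) =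
      {o | Set.ncard o.orbit = 1} ∪ {o | Set.ncard o.orbit = p ^ 4} := by
    refine (Set.eq_univ_of_forall fun o => ?_).symm
    induction o using Quotient.inductionOn' with | _ φ
    by_cases h : φ ∈ {φ | IsIdModCenter φ} ∪ {φ | IsCentral φ}
    · exact Or.inl (by rw [← h1] at h; exact h)
    · refine Or.inr (IsLine.ncard_orbit ((isIdModCenter_or_isLine φ).resolve_left
        fun k => h (Or.inl k)) fun k => h (Or.inr k))
  rw [← Set.ncard_univ, hu, Set.ncard_union_eq, ← c1, c2', Nat.mul_sub_one, ← pow_add]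
  · have : p ^ 12 ≤ p ^ 16 := Nat.pow_le_pow_right hp.pos (by norm_num)
    norm_num
    omega
  · refine Set.disjoint_left.2 fun o k k' => ?_
    rw [Set.mem_ofPred_eq] at k k'
    omega
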